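/- Let $(M,d)$ be a compact metric space with a Borel probability measure $p$ of full support, let $\Omega=M^{\mathbb N}$ with the product topology and the product $\sigma$-algebra $\mathscr F$, let $\sigma(x_1,x_2,\dots)=(x_2,x_3,\dots)$ be the shift, and let $f:\Omega\to\mathbb R$ be continuous. Write $S_nf=\sum_{j=0}^{n-1}f\circ\sigma^j$ and $$\mathscr L_f\varphi(x)=\int_M e^{f(ax)}\varphi(ax)\,dp(a),\qquad ax=(a,x_1,x_2,\dots),$$ and let $\mathscr L_f^*$ be the dual of $\mathscr L_f:C(\Omega)\to C(\Omega)$, acting on measures. Let $\lambda_f$ be the supremum of $\mathscr L_f^*\nu(1)$ over all Borel probability measures $\nu$ on $\Omega$ that are fixed points of $\gamma\mapsto \mathscr L_f^*\gamma/\mathscr L_f^*\gamma(1)$, and let $\mathscr G^*(f)$ be the set of Borel probability measures $\nu$ with $\mathscr L_f^*\nu=\lambda_f\nu$. Let $$K_n(E,x)=\frac{\mathscr L_f^n(1_E)(\sigma^nx)}{\mathscr L_f^n(1)(\sigma^nx)}\qquad(n\ge1,\ E\in\mathscr F,\ x\in\Omega),$$ and let $\mathscr G^{DLR}(f)$ be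 the set of Borel probability measures $\mu$ on $\Omega$ such that, for every $n\ge1$ and every $\varphi\in C(\Omega)$, $\mathbb E_\mu[\varphi\mid\sigma^n(\mathscr F)](x)=\int\varphi(y)\,K_n(dy,x)$ for $\mu$-almost every $x$, where $\sigma^n(\mathscr F)$ is the $\sigma$-algebra generated by the coordinates $x_k$, $k\ge n+1$. Put $$D=\sup_{n\ge1}\ \sup_{\substack{x,y\in\Omega\\ x_i=y_i,\ 1\le i\le n}}|S_nf(x)-S_nf(y)|\in[0,\infty].$$ (i) If $D<\infty$, then $\mathscr G^*(f)$ and $\mathscr G^{DLR}(f)$ are singletons, and they are equal. (ii) Let $d_\Omega(x,y)=\sum_{n\ge1}2^{-n}d(x_n,y_n)$. Then $D<\infty$, so that (i) applies, whenever $f$ satisfies one of the following conditions: - Hölder: there are $0<\gamma\le1$ and $C$ with $|f(x)-f(y)|\le C\,d_\Omega(x,y)^\gamma$ for all $x,y\in\Omega$; - weak Walters: for every $\varepsilon>0$ there is $\delta>0$ such that $|S_nf(x)-S_nf(y)|<\varepsilon$ for all $n\ge1$ and all $x,y\in\Omega$ with $x_i=y_i$ for $1\le i\le n$ and $d_\Omega(\sigma^nx,\sigma^ny)<\delta$;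 - Walters: for every $\varepsilon>0$ there is $\delta>0$ such that $|S_nf(x)-S_nf(y)|<\varepsilon$ for all $n\ge1$ and all $x,y\in\Omega$ with $d_\Omega(\sigma^ix,\sigma^iy)<\delta$ for $0\le i<n$; - Bowen: there are $\delta>0$ and $C$ such that $|S_nf(x)-S_nf(y)|\le C$ for all $n\ge1$ and all $x,y\in\Omega$ with $d_\Omega(\sigma^ix,\sigma^iy)<\delta$ for $0\le i<n$. -/

import Mathlib

open MeasureTheory Filter Topology Set
open scoped ENNReal

set_option linter.unusedSectionVars false

noncomputable section

namespace RuelleDLR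

/-! Sequences `x = (x₁, x₂, …)` are functions `ℕ → M`; the coordinate `x_{i+1}` is `x i`. -/

/-- The sequence `a x = (a, x₁, x₂, …)`. -/
def cons {M : Type*} (a : M) (x : ℕ → M) : ℕ → M
  | 0 => a
  | n + 1 => x n

/-- The left shift `σ (x₁, x₂, …) = (x₂, x₃, …)`. -/
def shift {M : Type*} (x : ℕ → M) : ℕ → M := fun n => x (n + 1)

/-- The Birkhoff sum `S_n f = f + f ∘ σ + ⋯ + f ∘ σ^{n-1}`. -/
def birkhoff {M : Type*} (f : (ℕ → M) → ℝ) (n : ℕ) (x : ℕ → M) : ℝ :=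
  ∑ j ∈ Finset.range n, f (shift^[j] x)

/-- The constant `D`: the supremum over `n ≥ 1` and over all `x`, `y` that agree on the first `n`
coordinates of `|S_n f x - S_n f y|`, as an element of `[0, ∞]`. -/
def bowenConst {M : Type*} (f : (ℕ → M) → ℝ) : ℝ≥0∞ :=
  ⨆ (n : ℕ) (_ : 1 ≤ n) (x : ℕ → M) (y : ℕ → M) (_ : ∀ i < n, x i = y i),
    ENNReal.ofReal |birkhoff f n x - birkhoff f n y|

/-- The metric `d_Ω(x, y) = ∑_{n ≥ 1} 2^{-n} d(x_n, y_n)`. -/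
def dOmega {M : Type*} [MetricSpace M] (x y : ℕ → M) : ℝ :=
  ∑' n : ℕ, (1 / 2 : ℝ) ^ (n + 1) * dist (x n) (y n)

/-- `f` is `γ`-Hölder for `d_Ω`, for some `0 < γ ≤ 1`. -/
def IsHolder {M : Type*} [MetricSpace M] (f : (ℕ → M) → ℝ) : Prop :=
  ∃ γ : ℝ, 0 < γ ∧ γ ≤ 1 ∧ ∃ C : ℝ, ∀ x y : ℕ → M, |f x - f y| ≤ C * dOmega x y ^ γ

/-- Weak Walters condition: `sup_n sup_{a ∈ Mⁿ} |S_n f (a u) - S_n f (a v)| → 0` as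
`d_Ω(u, v) → 0`. A pair `a u`, `a v` is written as a pair `x`, `y` that agrees on the first `n`
coordinates, with `u = σⁿ x` and `v = σⁿ y`. -/
def IsWeakWalters {M : Type*} [MetricSpace M] (f : (ℕ → M) → ℝ) : Prop :=
  ∀ ε : ℝ, 0 < ε → ∃ δ : ℝ, 0 < δ ∧ ∀ n : ℕ, 1 ≤ n → ∀ x y : ℕ → M, (∀ i < n, x i = y i) →
    dOmega (shift^[n] x) (shift^[n] y) < δ → |birkhoff f n x - birkhoff f n y| < ε

/-- Walters condition for the shift on `(Ω, d_Ω)`: for each `ε > 0` there is a `δ > 0` such that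
`|S_n f x - S_n f y| < ε` whenever the orbits of `x` and `y` stay `δ`-close up to time `n - 1`. -/
def IsWalters {M : Type*} [MetricSpace M] (f : (ℕ → M) → ℝ) : Prop :=
  ∀ ε : ℝ, 0 < ε → ∃ δ : ℝ, 0 < δ ∧ ∀ n : ℕ, 1 ≤ n → ∀ x y : ℕ → M,
    (∀ i < n, dOmega (shift^[i] x) (shift^[i] y) < δ) → |birkhoff f n x - birkhoff f n y| < ε

/-- Bowen condition for the shift on `(Ω, d_Ω)`: for some `δ > 0`, the differences
`|S_n f x - S_n f y|` are bounded uniformly in `n` and in the pairs `x`, `y` whose orbits stay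
`δ`-close up to time `n - 1`. -/
def IsBowen {M : Type*} [MetricSpace M] (f : (ℕ → M) → ℝ) : Prop :=
  ∃ δ : ℝ, 0 < δ ∧ ∃ C : ℝ, ∀ n : ℕ, 1 ≤ n → ∀ x y : ℕ → M,
    (∀ i < n, dOmega (shift^[i] x) (shift^[i] y) < δ) → |birkhoff f n x - birkhoff f n y| ≤ C

section Operator

variable {M : Type*} [MetricSpace M] [CompactSpace M] [MeasurableSpace M] [BorelSpace M]

/-- The formula `L_f φ (x) = ∫_M exp (f (a x)) φ (a x) dp(a)`, for arbitrary functions `φ`. -/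
def ruelleFun (p : Measure M) (f : C(ℕ → M, ℝ)) (φ : (ℕ → M) → ℝ) (x : ℕ → M) : ℝ :=
  ∫ a, Real.exp (f (cons a x)) * φ (cons a x) ∂p

theorem continuous_cons {M : Type*} [TopologicalSpace M] :
    Continuous (fun z : (ℕ → M) × M => cons z.2 z.1) := by
  refine continuous_pi fun n => ?_
  cases n with
  | zero => exact continuous_snd
  | succ n => exact (continuous_apply n).comp continuous_fst

theorem measurable_cons {M : Type*} [MeasurableSpace M] :
    Measurable (fun z : (ℕ → M) × M => cons z.2 z.1) := by
  refine measurable_pi_lambda _ fun n => ?_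
  cases n with
  | zero => exact measurable_snd
  | succ n => exact (measurable_pi_apply n).comp measurable_fst

theorem measurable_potential (f : C(ℕ → M, ℝ)) : Measurable f := by
  exact f.continuous.measurable

theorem exp_potential_le (f : C(ℕ → M, ℝ)) (z : ℕ → M) :
    Real.exp (f z) ≤ Real.exp ‖f‖ :=
  Real.exp_le_exp.2 ((le_abs_self _).trans (f.norm_coe_le_norm z))

/-- A bounded measurable function. -/
def BddMeas (φ : (ℕ → M) → ℝ) : Prop := Measurable φ ∧ ∃ c : ℝ, ∀ x, |φ x| ≤ c

theorem BddMeas.of_continuous (φ : C(ℕ → M, ℝ)) : BddMeas φ :=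
  ⟨measurable_potential φ, ‖φ‖, fun x => φ.norm_coe_le_norm x⟩

theorem BddMeas.indicator {E : Set (ℕ → M)} (hE : MeasurableSet E) :
    BddMeas (E.indicator (fun _ => (1 : ℝ))) := by
  refine ⟨measurable_const.indicator hE, 1, fun x => ?_⟩
  by_cases h : x ∈ E <;> simp [h]

theorem BddMeas.integrand (f : C(ℕ → M, ℝ)) {φ : (ℕ → M) → ℝ} (h : BddMeas φ) :
    Measurable (fun z : (ℕ → M) × M => Real.exp (f (cons z.2 z.1)) * φ (cons z.2 z.1)) ∧
      ∃ c : ℝ, ∀ x a, |Real.exp (f (cons a x)) * φ (cons a x)| ≤ c := by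
  obtain ⟨hm, c, hc⟩ := h
  refine ⟨((Real.measurable_exp.comp (measurable_potential f)).comp measurable_cons).mul
    (hm.comp measurable_cons), Real.exp ‖f‖ * c, fun x a => ?_⟩
  rw [abs_mul, Real.abs_exp]
  exact mul_le_mul (exp_potential_le f _) (hc _) (abs_nonneg _) (Real.exp_pos _).le

theorem BddMeas.integrable (p : Measure M) [IsProbabilityMeasure p] (f : C(ℕ → M, ℝ))
    {φ : (ℕ → M) → ℝ} (h : BddMeas φ) (x : ℕ → M) :
    Integrable (fun a => Real.exp (f (cons a x)) * φ (cons a x)) p := by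
  obtain ⟨hm, c, hc⟩ := h.integrand f
  exact Integrable.of_bound (hm.comp measurable_prodMk_left).aestronglyMeasurable c
    (Eventually.of_forall fun a => hc x a)

theorem BddMeas.ruelleFun (p : Measure M) [IsProbabilityMeasure p] (f : C(ℕ → M, ℝ))
    {φ : (ℕ → M) → ℝ} (h : BddMeas φ) : BddMeas (ruelleFun p f φ) := by
  obtain ⟨hm, c, hc⟩ := h.integrand f
  refine ⟨(hm.stronglyMeasurable.integral_prod_right (ν := p)).measurable, c, fun x => ?_⟩
  have h' : ∀ a, ‖Real.exp (f (cons a x)) * φ (cons a x)‖ ≤ c := fun a => hc x a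
  have := norm_integral_le_of_norm_le_const (μ := p) (Eventually.of_forall h')
  simpa [RuelleDLR.ruelleFun] using this

theorem BddMeas.iterate (p : Measure M) [IsProbabilityMeasure p] (f : C(ℕ → M, ℝ))
    {φ : (ℕ → M) → ℝ} (h : BddMeas φ) (n : ℕ) : BddMeas ((RuelleDLR.ruelleFun p f)^[n] φ) := by
  induction n with
  | zero => exact h
  | succ n ih => rw [Function.iterate_succ_apply']; exact ih.ruelleFun p f

theorem ruelleFun_nonneg (p : Measure M) (f : C(ℕ → M, ℝ)) {φ : (ℕ → M) → ℝ}
    (h : ∀ x, 0 ≤ φ x) (x : ℕ → M) : 0 ≤ ruelleFun p f φ x :=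
  integral_nonneg fun _ => mul_nonneg (Real.exp_pos _).le (h _)

theorem iterate_nonneg (p : Measure M) (f : C(ℕ → M, ℝ)) {φ : (ℕ → M) → ℝ}
    (h : ∀ x, 0 ≤ φ x) (n : ℕ) : ∀ x, 0 ≤ (ruelleFun p f)^[n] φ x := by
  induction n with
  | zero => exact h
  | succ n ih => rw [Function.iterate_succ_apply']; exact ruelleFun_nonneg p f ih

theorem ruelleFun_hasSum (p : Measure M) [IsProbabilityMeasure p] (f : C(ℕ → M, ℝ))
    {φ : ℕ → (ℕ → M) → ℝ} {ψ : (ℕ → M) → ℝ} (hφ : ∀ i, BddMeas (φ i))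
    (h0 : ∀ i x, 0 ≤ φ i x) (hψ : BddMeas ψ) (hs : ∀ x, HasSum (fun i => φ i x) (ψ x))
    (x : ℕ → M) : HasSum (fun i => ruelleFun p f (φ i) x) (ruelleFun p f ψ x) := by
  have key : ∀ a, HasSum (fun i => Real.exp (f (cons a x)) * φ i (cons a x))
      (Real.exp (f (cons a x)) * ψ (cons a x)) := fun a => (hs _).mul_left _
  refine hasSum_integral_of_dominated_convergence
    (fun i a => Real.exp (f (cons a x)) * φ i (cons a x))
    (fun i => ((hφ i).integrable p f x).aestronglyMeasurable)
    (fun i => Eventually.of_forall fun a => ?_)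
    (Eventually.of_forall fun a => (key a).summable) ?_ (Eventually.of_forall key)
  · rw [Real.norm_of_nonneg (mul_nonneg (Real.exp_pos _).le (h0 i _))]
  · simp_rw [(key _).tsum_eq]
    exact hψ.integrable p f x

theorem iterate_hasSum (p : Measure M) [IsProbabilityMeasure p] (f : C(ℕ → M, ℝ))
    {φ : ℕ → (ℕ → M) → ℝ} {ψ : (ℕ → M) → ℝ} (hφ : ∀ i, BddMeas (φ i))
    (h0 : ∀ i x, 0 ≤ φ i x) (hψ : BddMeas ψ) (hs : ∀ x, HasSum (fun i => φ i x) (ψ x))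
    (n : ℕ) : ∀ x, HasSum (fun i => (ruelleFun p f)^[n] (φ i) x) ((ruelleFun p f)^[n] ψ x) := by
  induction n with
  | zero => exact hs
  | succ n ih =>
    simp_rw [Function.iterate_succ_apply']
    exact ruelleFun_hasSum p f (fun i => (hφ i).iterate p f n)
      (fun i => iterate_nonneg p f (h0 i) n) (hψ.iterate p f n) ih

theorem ruelleFun_continuous (p : Measure M) [IsProbabilityMeasure p] (f φ : C(ℕ → M, ℝ)) :
    Continuous (ruelleFun p f φ) := by
  obtain ⟨-, c, hc⟩ := (BddMeas.of_continuous φ).integrand f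
  refine continuous_of_dominated
    (fun x => ((BddMeas.of_continuous φ).integrable p f x).aestronglyMeasurable)
    (fun x => Eventually.of_forall fun a => hc x a) (integrable_const c)
    (Eventually.of_forall fun a => ?_)
  have hc : Continuous (fun x : ℕ → M => cons a x) :=
    continuous_cons.comp (Continuous.prodMk continuous_id continuous_const)
  exact (Real.continuous_exp.comp (f.continuous.comp hc)).mul (φ.continuous.comp hc)

/-- The Ruelle operator `L_f` on `C(Ω)`, as a bounded linear operator. -/
def ruelleOp (p : Measure M) [IsProbabilityMeasure p] (f : C(ℕ → M, ℝ)) :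
    C(ℕ → M, ℝ) →L[ℝ] C(ℕ → M, ℝ) :=
  LinearMap.mkContinuous
    { toFun := fun φ => ⟨ruelleFun p f φ, ruelleFun_continuous p f φ⟩
      map_add' := fun φ ψ => by
        ext x
        simp only [ruelleFun, ContinuousMap.coe_mk, ContinuousMap.add_apply, mul_add]
        exact integral_add ((BddMeas.of_continuous φ).integrable p f x)
          ((BddMeas.of_continuous ψ).integrable p f x)
      map_smul' := fun c φ => by
        ext x
        simp only [ruelleFun, ContinuousMap.coe_mk, ContinuousMap.smul_apply, smul_eq_mul,
          RingHom.id_apply, ← integral_const_mul]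
        congr 1
        ext a
        ring }
    (Real.exp ‖f‖) (fun φ => by
      refine (ContinuousMap.norm_le _ (by positivity)).2 fun x => ?_
      have h : ∀ a, ‖Real.exp (f (cons a x)) * φ (cons a x)‖ ≤ Real.exp ‖f‖ * ‖φ‖ := fun a => by
        rw [norm_mul, Real.norm_eq_abs, Real.abs_exp]
        exact mul_le_mul (exp_potential_le f _) (φ.norm_coe_le_norm _) (norm_nonneg _)
          (Real.exp_pos _).le
      have := norm_integral_le_of_norm_le_const (μ := p) (Eventually.of_forall h)
      simpa [ruelleFun] using this)

/-- The dual operator `L_f^*` on the topological dual `C(Ω)^*`: `(L_f^* γ)(φ) = γ (L_f φ)`. -/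
def ruelleDual (p : Measure M) [IsProbabilityMeasure p] (f : C(ℕ → M, ℝ))
    (γ : StrongDual ℝ C(ℕ → M, ℝ)) : StrongDual ℝ C(ℕ → M, ℝ) :=
  γ.comp (ruelleOp p f)

/-- A Borel probability measure on `Ω`, seen in `C(Ω)^*` as the functional `φ ↦ ∫ φ dν`. -/
def toDual (ν : ProbabilityMeasure (ℕ → M)) : StrongDual ℝ C(ℕ → M, ℝ) :=
  LinearMap.mkContinuous
    { toFun := fun φ => ∫ x, φ x ∂(ν : Measure (ℕ → M))
      map_add' := fun φ ψ => by
        have hi : ∀ χ : C(ℕ → M, ℝ), Integrable χ (ν : Measure (ℕ → M)) := fun χ =>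
          Integrable.of_bound (measurable_potential χ).aestronglyMeasurable ‖χ‖
            (Eventually.of_forall fun x => χ.norm_coe_le_norm x)
        exact integral_add (hi φ) (hi ψ)
      map_smul' := fun c φ => integral_const_mul c _ }
    1 (fun φ => by
      have := norm_integral_le_of_norm_le_const (μ := (ν : Measure (ℕ → M)))
        (Eventually.of_forall fun x => φ.norm_coe_le_norm x)
      simpa using this)

/-- The eigenvalue `λ_f`: the supremum of `(L_f^* ν)(1)` over the probability measures `ν` that
are fixed by `γ ↦ L_f^* γ / (L_f^* γ)(1)`. -/
def eigenvalue (p : Measure M) [IsProbabilityMeasure p] (f : C(ℕ → M, ℝ)) : ℝ :=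
  sSup {r : ℝ | ∃ ν : ProbabilityMeasure (ℕ → M),
    (ruelleDual p f (toDual ν) 1)⁻¹ • ruelleDual p f (toDual ν) = toDual ν ∧
      r = ruelleDual p f (toDual ν) 1}

/-- `G^*(f)`: the probability measures `ν` with `L_f^* ν = λ_f ν`. -/
def eigenProbs (p : Measure M) [IsProbabilityMeasure p] (f : C(ℕ → M, ℝ)) :
    Set (ProbabilityMeasure (ℕ → M)) :=
  {ν | ruelleDual p f (toDual ν) = eigenvalue p f • toDual ν}

theorem hasSum_indicator {α : Type*} {E : ℕ → Set α}
    (hd : Pairwise (Function.onFun Disjoint E)) (y : α) :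
    HasSum (fun i => (E i).indicator (fun _ => (1 : ℝ)) y)
      ((⋃ i, E i).indicator (fun _ => (1 : ℝ)) y) := by
  by_cases hy : y ∈ ⋃ i, E i
  · obtain ⟨i, hi⟩ := Set.mem_iUnion.1 hy
    have h : (⋃ i, E i).indicator (fun _ => (1 : ℝ)) y = (E i).indicator (fun _ => (1 : ℝ)) y := by
      rw [Set.indicator_of_mem hy, Set.indicator_of_mem hi]
    rw [h]
    refine hasSum_single i fun j hj => Set.indicator_of_notMem (fun hjy => ?_) _
    exact Set.disjoint_left.1 (hd hj) hjy hi
  · rw [Set.indicator_of_notMem hy]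
    have h : ∀ i, (E i).indicator (fun _ => (1 : ℝ)) y = 0 := fun i =>
      Set.indicator_of_notMem (fun hi => hy (Set.mem_iUnion.2 ⟨i, hi⟩)) _
    simp only [h]
    exact hasSum_zero

/-- The kernel `K_n(E, x) = L_f^n(1_E)(σ^n x) / L_f^n(1)(σ^n x)`, as a measure in `E`. -/
def gibbsKernel (p : Measure M) [IsProbabilityMeasure p] (f : C(ℕ → M, ℝ)) (n : ℕ)
    (x : ℕ → M) : Measure (ℕ → M) :=
  Measure.ofMeasurable
    (fun E _ => ENNReal.ofReal
      ((ruelleFun p f)^[n] (E.indicator fun _ => 1) (shift^[n] x) /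
        (ruelleFun p f)^[n] (fun _ => 1) (shift^[n] x)))
    (by
      have h : ∀ n : ℕ, (ruelleFun p f)^[n] (fun _ : ℕ → M => (0 : ℝ)) = fun _ => 0 := fun n => by
        induction n with
        | zero => rfl
        | succ n ih => rw [Function.iterate_succ_apply', ih]; ext x; simp [ruelleFun]
      simp [h])
    (fun E hE hd => by
      have hone : ∀ y, 0 ≤ (ruelleFun p f)^[n] (fun _ => (1 : ℝ)) y :=
        iterate_nonneg p f (fun _ => zero_le_one) n
      have hnn : ∀ i y, 0 ≤ (E i).indicator (fun _ => (1 : ℝ)) y := fun i y =>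
        Set.indicator_nonneg (fun _ _ => zero_le_one) y
      have hsum := (iterate_hasSum p f (fun i => BddMeas.indicator (hE i)) hnn
        (BddMeas.indicator (MeasurableSet.iUnion hE))
        (hasSum_indicator hd) n
        (shift^[n] x)).div_const ((ruelleFun p f)^[n] (fun _ => 1) (shift^[n] x))
      rw [← hsum.tsum_eq, ENNReal.ofReal_tsum_of_nonneg _ hsum.summable]
      exact fun i => div_nonneg (iterate_nonneg p f (hnn i) n _) (hone _))

/-- The defining formula of the kernel. -/
theorem gibbsKernel_apply (p : Measure M) [IsProbabilityMeasure p] (f : C(ℕ → M, ℝ)) (n : ℕ)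
    (x : ℕ → M) {E : Set (ℕ → M)} (hE : MeasurableSet E) :
    gibbsKernel p f n x E = ENNReal.ofReal
      ((ruelleFun p f)^[n] (E.indicator fun _ => 1) (shift^[n] x) /
        (ruelleFun p f)^[n] (fun _ => 1) (shift^[n] x)) :=
  Measure.ofMeasurable_apply E hE

/-- The `σ`-algebra `σ^n(F)` generated by the coordinates with (one-based) index at least
`n + 1`. -/
@[reducible]
def tailSigma (M : Type*) [MeasurableSpace M] (n : ℕ) : MeasurableSpace (ℕ → M) :=
  ⨆ k ∈ Set.Ici n, MeasurableSpace.comap (fun x : ℕ → M => x k) inferInstance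

/-- `G^{DLR}(f)`: the probability measures `μ` such that, for all `n ≥ 1` and all continuous `φ`,
`E_μ[φ | σ^n(F)](x) = ∫ φ dK_n(·, x)` for `μ`-almost all `x`. -/
def dlrMeasures (p : Measure M) [IsProbabilityMeasure p] (f : C(ℕ → M, ℝ)) :
    Set (ProbabilityMeasure (ℕ → M)) :=
  {μ | ∀ n : ℕ, 1 ≤ n → ∀ φ : C(ℕ → M, ℝ),
    (μ : Measure (ℕ → M))[φ | tailSigma M n] =ᵐ[(μ : Measure (ℕ → M))]
      fun x => ∫ y, φ y ∂(gibbsKernel p f n x)}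

end Operator

end RuelleDLR

end

/-! Write `A_n φ = L^n φ / L^n 1` (`gibbsMean`). The kernels are consistent
(`gibbsMean_comp_shift`), so `A_{m+k} φ` averages values of `A_m φ`: its infimum `a_n` increases and
its supremum `b_n` decreases. Bounded distortion makes these limits equal. Along a common word of
length `n` the weights `e^{S_n f}` above two points differ by a factor at most `e^D`, so for
nonnegative functions `A_n` at two points compares up to `e^{2D}` and a small error
(`gibbsMean_le_mul_add`). Applied to `A_m φ ∘ σ^m - a_m`, this gives `b_n - a_m ≤ e^{2D} (a_n - a_m)
+ ε` for large `n`, which forces `lim a = lim b`.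

Hence `A_n φ` converges uniformly to a constant, which by compactness is `∫ φ dν` for one measure
`ν` (`IsGibbsLimit`). For an eigenprobability or a DLR measure `μ`, `∫ φ dμ` is a mean of values of
`A_n φ`, so `μ = ν`. Conversely `ν` is an eigenprobability, and eigenprobabilities are DLR.

The regularity conditions bound `S_n f x - S_n f y` when `x`, `y` agree on `n + N` coordinates;
passing to `n` coordinates costs at most `2 N ‖f‖`. -/

noncomputable section

namespace RuelleDLR

/-! ### Shift, Birkhoff sums and the tail σ-algebra -/

theorem shift_iterate_apply {M : Type*} (n : ℕ) (x : ℕ → M) (k : ℕ) :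
    shift^[n] x k = x (k + n) := by
  induction n generalizing x with
  | zero => rfl
  | succ n ih =>
    rw [Function.iterate_succ_apply, ih, shift]
    congr 1

theorem shift_cons {M : Type*} (a : M) (x : ℕ → M) : shift (cons a x) = x := rfl

theorem shift_iterate_surjective {M : Type*} (n : ℕ) :
    Function.Surjective (shift^[n] : (ℕ → M) → ℕ → M) := fun z =>
  ⟨fun k => z (k - n), by ext k; simp [shift_iterate_apply]⟩

theorem continuous_shift_iterate {M : Type*} [TopologicalSpace M] (n : ℕ) :
    Continuous (shift^[n] : (ℕ → M) → ℕ → M) :=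
  continuous_pi fun k => by simpa only [shift_iterate_apply] using continuous_apply (k + n)

theorem measurable_shift_iterate {M : Type*} [MeasurableSpace M] (n : ℕ) :
    Measurable (shift^[n] : (ℕ → M) → ℕ → M) :=
  measurable_pi_lambda _ fun k => by
    simpa only [shift_iterate_apply] using measurable_pi_apply (k + n)

theorem birkhoff_zero {M : Type*} (f : (ℕ → M) → ℝ) (x : ℕ → M) : birkhoff f 0 x = 0 := by
  simp [birkhoff]

theorem birkhoff_succ_cons {M : Type*} (f : (ℕ → M) → ℝ) (n : ℕ) (a : M) (x : ℕ → M) :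
    birkhoff f (n + 1) (cons a x) = f (cons a x) + birkhoff f n x := by
  simp [birkhoff, Finset.sum_range_succ', shift_cons, add_comm]

/-- `S_{m+n} f = S_m f + S_n f ∘ σ^m`. -/
theorem birkhoff_add {M : Type*} (f : (ℕ → M) → ℝ) (m n : ℕ) (x : ℕ → M) :
    birkhoff f (m + n) x = birkhoff f m x + birkhoff f n (shift^[m] x) := by
  simp only [birkhoff, Finset.sum_range_add, ← Function.iterate_add_apply, Nat.add_comm]

/-- Tail events thus have the form `σ^{-n} B`, and their indicators are functions of `σ^n`, which
`L^n` lets through. -/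
theorem tailSigma_eq_comap (M : Type*) [MeasurableSpace M] (n : ℕ) :
    tailSigma M n = MeasurableSpace.comap (shift^[n]) MeasurableSpace.pi := by
  simp only [tailSigma, MeasurableSpace.pi, MeasurableSpace.comap_iSup,
    MeasurableSpace.comap_comp]
  refine le_antisymm (iSup₂_le fun k hk => ?_) (iSup_le fun k => ?_)
  · refine le_iSup_of_le (k - n) (le_of_eq ?_)
    congr 1
    ext x
    simp [shift_iterate_apply, Nat.sub_add_cancel (Set.mem_Ici.1 hk)]
  · refine le_iSup₂_of_le (k + n) (Set.mem_Ici.2 (Nat.le_add_left _ _)) (le_of_eq ?_)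
    congr 1
    ext x
    simp [shift_iterate_apply]

/-! ### Iterates of the Ruelle operator and their normalization -/

section Operator

variable {M : Type*} [MetricSpace M] [CompactSpace M] [MeasurableSpace M] [BorelSpace M]

theorem BddMeas.const (c : ℝ) : BddMeas (fun _ : ℕ → M => c) :=
  ⟨measurable_const, |c|, fun _ => le_rfl⟩

theorem BddMeas.integrable_measure {φ : (ℕ → M) → ℝ} (h : BddMeas φ) (m : Measure (ℕ → M))
    [IsFiniteMeasure m] : Integrable φ m := by
  obtain ⟨hm, c, hc⟩ := h
  exact Integrable.of_bound hm.aestronglyMeasurable c (Eventually.of_forall hc)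

theorem BddMeas.mul {φ ψ : (ℕ → M) → ℝ} (h : BddMeas φ) (h' : BddMeas ψ) :
    BddMeas (fun x => φ x * ψ x) := by
  obtain ⟨hm, c, hc⟩ := h
  obtain ⟨hm', c', hc'⟩ := h'
  refine ⟨hm.mul hm', c * c', fun x => ?_⟩
  rw [abs_mul]
  exact mul_le_mul (hc x) (hc' x) (abs_nonneg _) ((abs_nonneg _).trans (hc x))

theorem BddMeas.add {φ ψ : (ℕ → M) → ℝ} (h : BddMeas φ) (h' : BddMeas ψ) :
    BddMeas (fun x => φ x + ψ x) := by
  obtain ⟨hm, c, hc⟩ := h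
  obtain ⟨hm', c', hc'⟩ := h'
  exact ⟨hm.add hm', c + c', fun x => (abs_add_le _ _).trans (add_le_add (hc x) (hc' x))⟩

theorem BddMeas.comp_shift_iterate {φ : (ℕ → M) → ℝ} (h : BddMeas φ) (n : ℕ) :
    BddMeas (fun x => φ (shift^[n] x)) := by
  obtain ⟨hm, c, hc⟩ := h
  exact ⟨hm.comp (measurable_shift_iterate n), c, fun x => hc _⟩

/-- The dual of the Ruelle operator acts on finite measures. -/
theorem exists_measure_integral_ruelleFun (p : Measure M) [IsProbabilityMeasure p]
    (f : C(ℕ → M, ℝ)) (m : Measure (ℕ → M)) [IsFiniteMeasure m] :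
    ∃ m' : Measure (ℕ → M), IsFiniteMeasure m' ∧
      ∀ φ, BddMeas φ → ∫ x, ruelleFun p f φ x ∂m = ∫ x, φ x ∂m' := by
  have hme : Measurable fun x => ENNReal.ofReal (Real.exp (f x)) :=
    (Real.measurable_exp.comp (measurable_potential f)).ennreal_ofReal
  -- Prepend a `p`-random letter to an `m`-random sequence, then weight by `e^f`; the identity is
  -- Fubini.
  refine ⟨((m.prod p).map fun z => cons z.2 z.1).withDensity
    fun x => ENNReal.ofReal (Real.exp (f x)), ?_, fun φ h => ?_⟩
  · refine isFiniteMeasure_withDensity_ofReal (Integrable.hasFiniteIntegral ?_)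
    exact Integrable.of_bound
      (Real.measurable_exp.comp (measurable_potential f)).aestronglyMeasurable (Real.exp ‖f‖)
      (Eventually.of_forall fun x => by simpa using (le_abs_self _).trans (f.norm_coe_le_norm x))
  · rw [integral_withDensity_eq_integral_toReal_smul hme
      (Eventually.of_forall fun _ => ENNReal.ofReal_lt_top)]
    simp only [ENNReal.toReal_ofReal (Real.exp_pos _).le, smul_eq_mul]
    have hmm : Measurable fun x => Real.exp (f x) * φ x :=
      (Real.measurable_exp.comp (measurable_potential f)).mul h.1
    rw [integral_map measurable_cons.aemeasurable hmm.aestronglyMeasurable]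
    obtain ⟨hm, c, hc⟩ := h.integrand f
    exact (integral_prod _ (Integrable.of_bound hm.aestronglyMeasurable c
      (Eventually.of_forall fun z => hc z.1 z.2))).symm

/-- The iterates of the Ruelle operator are given by finite measures. -/
theorem exists_measure_iterate_ruelleFun (p : Measure M) [IsProbabilityMeasure p]
    (f : C(ℕ → M, ℝ)) (n : ℕ) (x : ℕ → M) :
    ∃ m : Measure (ℕ → M), IsFiniteMeasure m ∧
      ∀ φ, BddMeas φ → (ruelleFun p f)^[n] φ x = ∫ y, φ y ∂m := by
  induction n with
  | zero =>
    refine ⟨Measure.dirac x, inferInstance, fun φ h => ?_⟩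
    rw [integral_dirac' _ _ h.1.stronglyMeasurable]
    rfl
  | succ n ih =>
    obtain ⟨m, hm, hφ⟩ := ih
    obtain ⟨m', hm', hφ'⟩ := exists_measure_integral_ruelleFun p f m
    refine ⟨m', hm', fun φ h => ?_⟩
    rw [Function.iterate_succ_apply, hφ _ (h.ruelleFun p f), hφ' φ h]

theorem iterate_ruelleFun_const_mul (p : Measure M) [IsProbabilityMeasure p] (f : C(ℕ → M, ℝ))
    {φ : (ℕ → M) → ℝ} (h : BddMeas φ) (c : ℝ) (n : ℕ) (x : ℕ → M) :
    (ruelleFun p f)^[n] (fun y => c * φ y) x = c * (ruelleFun p f)^[n] φ x := by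
  obtain ⟨m, hm, hφ⟩ := exists_measure_iterate_ruelleFun p f n x
  rw [hφ _ h, hφ _ ((BddMeas.const c).mul h), integral_const_mul]

theorem iterate_ruelleFun_add (p : Measure M) [IsProbabilityMeasure p] (f : C(ℕ → M, ℝ))
    {φ ψ : (ℕ → M) → ℝ} (h : BddMeas φ) (h' : BddMeas ψ) (n : ℕ) (x : ℕ → M) :
    (ruelleFun p f)^[n] (fun y => φ y + ψ y) x =
      (ruelleFun p f)^[n] φ x + (ruelleFun p f)^[n] ψ x := by
  obtain ⟨m, hm, hφ⟩ := exists_measure_iterate_ruelleFun p f n x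
  rw [hφ _ h, hφ _ h', hφ _ (h.add h'),
    integral_add (h.integrable_measure m) (h'.integrable_measure m)]

/-- As `f ≥ -‖f‖` and `p` has mass one, each application of `L` costs at most a factor `e^{-‖f‖}`.
-/
theorem iterate_ruelleFun_one_pos (p : Measure M) [IsProbabilityMeasure p] (f : C(ℕ → M, ℝ))
    (n : ℕ) (x : ℕ → M) : 0 < (ruelleFun p f)^[n] (fun _ => 1) x := by
  suffices h : Real.exp (-‖f‖) ^ n ≤ (ruelleFun p f)^[n] (fun _ => 1) x from
    lt_of_lt_of_le (by positivity) h
  induction n generalizing x with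
  | zero => simp
  | succ n ih =>
    rw [Function.iterate_succ_apply']
    have h : ∀ a, Real.exp (-‖f‖) ^ (n + 1) ≤
        Real.exp (f (cons a x)) * (ruelleFun p f)^[n] (fun _ => 1) (cons a x) := fun a => by
      rw [pow_succ']
      exact mul_le_mul (Real.exp_le_exp.2 (neg_le_of_abs_le (f.norm_coe_le_norm _))) (ih _)
        (by positivity) (Real.exp_pos _).le
    have := integral_mono (integrable_const _)
      ((((BddMeas.const (M := M) 1)).iterate p f n).integrable p f x) h
    simpa [ruelleFun] using this

/-- Functions of `σ^n` can be pulled out of `L_f^n`. -/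
theorem iterate_ruelleFun_comp_shift_mul (p : Measure M) (f : C(ℕ → M, ℝ))
    (g φ : (ℕ → M) → ℝ) (n : ℕ) (x : ℕ → M) :
    (ruelleFun p f)^[n] (fun y => g (shift^[n] y) * φ y) x =
      g x * (ruelleFun p f)^[n] φ x := by
  induction n generalizing φ with
  | zero => rfl
  | succ n ih =>
    rw [Function.iterate_succ_apply, Function.iterate_succ_apply, ← ih]
    refine congrFun (congrArg _ (funext fun y => ?_)) x
    -- `σ^{n+1}(a y) = σ^n y` does not depend on `a`, so the factor leaves the integral.
    simp only [ruelleFun, Function.iterate_succ_apply, shift_cons, ← integral_const_mul]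
    congr 1
    ext a
    ring

theorem iterate_ruelleFun_continuous (p : Measure M) [IsProbabilityMeasure p]
    (f φ : C(ℕ → M, ℝ)) (n : ℕ) : Continuous ((ruelleFun p f)^[n] φ) := by
  induction n with
  | zero => exact φ.continuous
  | succ n ih =>
    rw [Function.iterate_succ_apply']
    exact ruelleFun_continuous p f ⟨_, ih⟩

/-- Comparison of `L_f^n` at two points. -/
theorem iterate_ruelleFun_le_of_agree (p : Measure M) [IsProbabilityMeasure p]
    (f : C(ℕ → M, ℝ)) {z w : ℕ → M} (n : ℕ) {φ χ : (ℕ → M) → ℝ} (hφ : BddMeas φ)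
    (hχ : BddMeas χ)
    (h : ∀ x y, (∀ i < n, x i = y i) → shift^[n] x = z → shift^[n] y = w →
      Real.exp (birkhoff f n x) * φ x ≤ Real.exp (birkhoff f n y) * χ y) :
    (ruelleFun p f)^[n] φ z ≤ (ruelleFun p f)^[n] χ w := by
  -- Peeling off the innermost `L` prepends one common letter to both points; with `φ` and `χ` free,
  -- this replaces an explicit `n`-fold integral over words.
  induction n generalizing φ χ with
  | zero => simpa [birkhoff_zero] using h z w (by simp) rfl rfl
  | succ n ih =>
    rw [Function.iterate_succ_apply, Function.iterate_succ_apply]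
    refine ih (hφ.ruelleFun p f) (hχ.ruelleFun p f) fun x y hxy hx hy => ?_
    simp only [ruelleFun, ← integral_const_mul]
    refine integral_mono ((hφ.integrable p f x).const_mul _) ((hχ.integrable p f y).const_mul _)
      fun a => ?_
    have := h (cons a x) (cons a y) (fun i hi => ?_) (by simpa [shift_cons] using hx)
      (by simpa [shift_cons] using hy)
    · simp only [birkhoff_succ_cons, add_comm (f _), Real.exp_add] at this
      simpa only [mul_assoc] using this
    · cases i with
      | zero => rfl
      | succ i => exact hxy i (by omega)

/-- The normalized iterate `L_f^n φ / L_f^n 1`. -/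
def gibbsMean (p : Measure M) (f : C(ℕ → M, ℝ)) (n : ℕ) (φ : (ℕ → M) → ℝ) (z : ℕ → M) : ℝ :=
  (ruelleFun p f)^[n] φ z / (ruelleFun p f)^[n] (fun _ => 1) z

theorem iterate_ruelleFun_eq_gibbsMean_mul (p : Measure M) [IsProbabilityMeasure p]
    (f : C(ℕ → M, ℝ)) (n : ℕ) (φ : (ℕ → M) → ℝ) (z : ℕ → M) :
    (ruelleFun p f)^[n] φ z = gibbsMean p f n φ z * (ruelleFun p f)^[n] (fun _ => 1) z :=
  (div_mul_cancel₀ _ (iterate_ruelleFun_one_pos p f n z).ne').symm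

/-- The kernel is the normalization of the measure representing `φ ↦ L^n φ (σ^n x)`, so no
approximation by simple functions is needed. -/
theorem gibbsKernel_spec (p : Measure M) [IsProbabilityMeasure p] (f : C(ℕ → M, ℝ)) (n : ℕ)
    (x : ℕ → M) : IsProbabilityMeasure (gibbsKernel p f n x) ∧ ∀ φ, BddMeas φ →
      ∫ y, φ y ∂(gibbsKernel p f n x) = gibbsMean p f n φ (shift^[n] x) := by
  obtain ⟨m, hm, hφ⟩ := exists_measure_iterate_ruelleFun p f n (shift^[n] x)
  have hpos := iterate_ruelleFun_one_pos p f n (shift^[n] x)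
  have key : gibbsKernel p f n x =
      ENNReal.ofReal ((ruelleFun p f)^[n] (fun _ => 1) (shift^[n] x))⁻¹ • m := by
    ext E hE
    rw [gibbsKernel_apply p f n x hE, hφ _ (BddMeas.indicator hE), div_eq_inv_mul,
      ENNReal.ofReal_mul (by positivity), integral_indicator_const _ hE]
    simp
  constructor
  · constructor
    rw [gibbsKernel_apply p f n x MeasurableSet.univ]
    simp [div_self hpos.ne']
  · intro φ h
    rw [key, integral_smul_measure, gibbsMean, hφ φ h, ENNReal.toReal_ofReal (by positivity),
      smul_eq_mul, div_eq_inv_mul]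

instance (p : Measure M) [IsProbabilityMeasure p] (f : C(ℕ → M, ℝ)) (n : ℕ) (x : ℕ → M) :
    IsProbabilityMeasure (gibbsKernel p f n x) := (gibbsKernel_spec p f n x).1

theorem integral_gibbsKernel (p : Measure M) [IsProbabilityMeasure p] (f : C(ℕ → M, ℝ)) (n : ℕ)
    (x : ℕ → M) {φ : (ℕ → M) → ℝ} (h : BddMeas φ) :
    ∫ y, φ y ∂(gibbsKernel p f n x) = gibbsMean p f n φ (shift^[n] x) :=
  (gibbsKernel_spec p f n x).2 φ h

theorem gibbsMean_continuous (p : Measure M) [IsProbabilityMeasure p]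
    (f φ : C(ℕ → M, ℝ)) (n : ℕ) : Continuous (gibbsMean p f n φ) :=
  (iterate_ruelleFun_continuous p f φ n).div (iterate_ruelleFun_continuous p f 1 n)
    fun x => (iterate_ruelleFun_one_pos p f n x).ne'

end Operator

/-! ### Squeezing sequences and approximation on cylinders -/

theorem exists_bound_of_bowenConst_lt_top {M : Type*} {f : (ℕ → M) → ℝ}
    (h : bowenConst f < ⊤) : ∃ D : ℝ, ∀ n, ∀ x y : ℕ → M, (∀ i < n, x i = y i) →
      |birkhoff f n x - birkhoff f n y| ≤ D := by
  refine ⟨(bowenConst f).toReal, fun n x y hxy => ?_⟩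
  rcases Nat.eq_zero_or_pos n with rfl | hn
  · simp [birkhoff_zero]
  · refine (ENNReal.ofReal_le_iff_le_toReal h.ne).1 ?_
    exact le_iSup₂_of_le n hn (le_iSup₂_of_le x y (le_iSup_of_le hxy le_rfl))

/-- Monotone sequences `a ≤ b` whose gaps satisfy `b_n - a_m ≤ C (a_n - a_m) + ε` for large `n`
have a common limit. -/
theorem exists_common_limit {a b : ℕ → ℝ} (ha : Monotone a) (hb : Antitone b)
    (hab : ∀ n, a n ≤ b n) (C : ℝ)
    (h : ∀ m, ∀ ε : ℝ, 0 < ε → ∀ᶠ n in atTop, b n - a m ≤ C * (a n - a m) + ε) :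
    ∃ l, Tendsto a atTop (𝓝 l) ∧ Tendsto b atTop (𝓝 l) := by
  have hab' : ∀ m n, a m ≤ b n := fun m n =>
    (ha (le_max_left m n)).trans ((hab _).trans (hb (le_max_right m n)))
  have hA := tendsto_atTop_ciSup ha ⟨b 0, by rintro _ ⟨m, rfl⟩; exact hab' m 0⟩
  have hB := tendsto_atTop_ciInf hb ⟨a 0, by rintro _ ⟨m, rfl⟩; exact hab' 0 m⟩
  set A := ⨆ i, a i
  set B := ⨅ i, b i
  -- Let `n → ∞` with `m` fixed; `ε` is arbitrary.
  have h1 : ∀ m, B - a m ≤ C * (A - a m) := fun m => le_of_forall_pos_le_add fun ε hε =>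
    le_of_tendsto_of_tendsto (hB.sub_const _) (((hA.sub_const _).const_mul C).add_const ε)
      (h m ε hε)
  -- Now `m → ∞`: the right side vanishes however large `C` is.
  have h2 : B - A ≤ C * (A - A) :=
    le_of_tendsto_of_tendsto' (hA.const_sub B) ((hA.const_sub A).const_mul C) h1
  have h3 : A ≤ B := le_of_tendsto_of_tendsto' hA hB hab
  have : A = B := le_antisymm h3 (by simpa using h2)
  exact ⟨A, hA, this ▸ hB⟩

/-- A continuous function on the product space is approximated by functions of finitely many
coordinates. -/
theorem exists_forall_agree_abs_sub_lt {M : Type*} [MetricSpace M] [CompactSpace M]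
    (φ : C(ℕ → M, ℝ)) {ε : ℝ} (hε : 0 < ε) :
    ∃ N, ∀ x y : ℕ → M, (∀ i < N, x i = y i) → |φ x - φ y| < ε := by
  have hu := CompactSpace.uniformContinuous_of_continuous φ.continuous
  have hmem := hu (Metric.dist_mem_uniformity hε)
  rw [Filter.mem_map, Pi.uniformity, Filter.mem_iInf] at hmem
  obtain ⟨I, hI, V, hV, hVeq⟩ := hmem
  -- An entourage of the product constrains only the finitely many coordinates in `I`.
  obtain ⟨N, hN⟩ := hI.bddAbove
  refine ⟨N + 1, fun x y hxy => ?_⟩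
  have : (x, y) ∈ ⋂ i : I, V i := by
    refine Set.mem_iInter.2 fun i => ?_
    obtain ⟨t, ht, hts⟩ := Filter.mem_comap.1 (hV i)
    refine hts ?_
    show (x i, y i) ∈ t
    rw [hxy i (Nat.lt_succ_of_le (hN i.2))]
    exact refl_mem_uniformity ht
  rw [← hVeq] at this
  exact this

/-! ### Bounded distortion and convergence of the normalized iterates -/

section Operator

variable {M : Type*} [MetricSpace M] [CompactSpace M] [MeasurableSpace M] [BorelSpace M]

/-- One factor `e^D` compares the numerators, the other the denominators; `ε` absorbs the variation
of `φ` on cylinders of length `n`. -/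
theorem gibbsMean_le_mul_add (p : Measure M) [IsProbabilityMeasure p] (f : C(ℕ → M, ℝ)) {D : ℝ}
    (n : ℕ) (hD : ∀ x y : ℕ → M, (∀ i < n, x i = y i) →
      |birkhoff f n x - birkhoff f n y| ≤ D)
    {φ : (ℕ → M) → ℝ} (hφ : BddMeas φ) (h0 : ∀ x, 0 ≤ φ x) {ε : ℝ}
    (hε : ∀ x y : ℕ → M, (∀ i < n, x i = y i) → φ x ≤ φ y + ε) (z w : ℕ → M) :
    gibbsMean p f n φ z ≤ Real.exp D * Real.exp D * (gibbsMean p f n φ w + ε) := by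
  have hexp : ∀ x y : ℕ → M, (∀ i < n, x i = y i) →
      Real.exp (birkhoff f n x) ≤ Real.exp (birkhoff f n y) * Real.exp D := fun x y hxy => by
    rw [← Real.exp_add, Real.exp_le_exp]
    linarith [le_of_abs_le (hD x y hxy)]
  have hzw : (ruelleFun p f)^[n] φ z ≤ Real.exp D *
      ((ruelleFun p f)^[n] φ w + ε * (ruelleFun p f)^[n] (fun _ => 1) w) := by
    have hB : BddMeas (fun _ : ℕ → M => ε * 1) := (BddMeas.const ε).mul (BddMeas.const 1)
    rw [← iterate_ruelleFun_const_mul p f (BddMeas.const 1), ← iterate_ruelleFun_add p f hφ hB,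
      ← iterate_ruelleFun_const_mul p f (hφ.add hB)]
    refine iterate_ruelleFun_le_of_agree p f n hφ ((BddMeas.const _).mul (hφ.add hB))
      fun x y hxy _ _ => ?_
    rw [← mul_assoc, mul_one]
    exact mul_le_mul (hexp x y hxy) (hε x y hxy) (h0 x) (by positivity)
  have hwz : (ruelleFun p f)^[n] (fun _ => 1) w ≤
      Real.exp D * (ruelleFun p f)^[n] (fun _ => 1) z := by
    rw [← iterate_ruelleFun_const_mul p f (BddMeas.const 1)]
    refine iterate_ruelleFun_le_of_agree p f n (BddMeas.const 1)
      ((BddMeas.const _).mul (BddMeas.const 1)) fun x y hxy _ _ => ?_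
    simpa using hexp x y hxy
  have hz := iterate_ruelleFun_one_pos p f n z
  have hw := iterate_ruelleFun_one_pos p f n w
  rw [iterate_ruelleFun_eq_gibbsMean_mul p f n φ w, ← add_mul] at hzw
  have hnn : 0 ≤ gibbsMean p f n φ w + ε := by
    have : 0 ≤ ε := by linarith [hε w w fun _ _ => rfl]
    exact add_nonneg (div_nonneg (iterate_nonneg p f h0 n w) hw.le) this
  rw [gibbsMean, div_le_iff₀ hz]
  calc _ ≤ _ := hzw
    _ ≤ Real.exp D * ((gibbsMean p f n φ w + ε) *
        (Real.exp D * (ruelleFun p f)^[n] (fun _ => 1) z)) := by gcongr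
    _ = _ := by ring

/-- Consistency of the kernels: pulling `A_m φ ∘ σ^m` out of `L^m` gives `A_m φ · L^m 1 = L^m φ`;
then apply `L^k`. -/
theorem gibbsMean_comp_shift (p : Measure M) [IsProbabilityMeasure p] (f : C(ℕ → M, ℝ))
    (m k : ℕ) (φ : (ℕ → M) → ℝ) (z : ℕ → M) :
    gibbsMean p f (m + k) (fun x => gibbsMean p f m φ (shift^[m] x)) z =
      gibbsMean p f (m + k) φ z := by
  rw [gibbsMean, gibbsMean, add_comm, Function.iterate_add_apply,
    Function.iterate_add_apply _ k m φ]
  congr 1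
  refine congrFun (congrArg _ (funext fun x => ?_)) z
  have := iterate_ruelleFun_comp_shift_mul p f (gibbsMean p f m φ) (fun _ => 1) m x
  simp only [mul_one] at this
  rw [this, ← iterate_ruelleFun_eq_gibbsMean_mul]

theorem gibbsMean_mem_Icc (p : Measure M) [IsProbabilityMeasure p] (f : C(ℕ → M, ℝ)) (n : ℕ)
    {φ : (ℕ → M) → ℝ} (h : BddMeas φ) {a b : ℝ} (hab : ∀ x, φ x ∈ Icc a b) (z : ℕ → M) :
    gibbsMean p f n φ z ∈ Icc a b := by
  -- The kernel at `x` depends only on `σ^n x`, so any preimage of `z` serves.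
  obtain ⟨x, rfl⟩ := shift_iterate_surjective n z
  rw [← integral_gibbsKernel p f n x h]
  constructor
  · simpa using integral_mono (integrable_const a) (h.integrable_measure (gibbsKernel p f n x))
      fun y => (hab y).1
  · simpa using integral_mono (h.integrable_measure (gibbsKernel p f n x)) (integrable_const b)
      fun y => (hab y).2

theorem gibbsMean_sub_const (p : Measure M) [IsProbabilityMeasure p] (f : C(ℕ → M, ℝ)) (n : ℕ)
    {φ : (ℕ → M) → ℝ} (h : BddMeas φ) (c : ℝ) (z : ℕ → M) :
    gibbsMean p f n (fun x => φ x - c) z = gibbsMean p f n φ z - c := by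
  obtain ⟨x, rfl⟩ := shift_iterate_surjective n z
  have hc : BddMeas fun x => φ x - c := by
    simpa only [sub_eq_add_neg] using h.add (BddMeas.const (-c))
  rw [← integral_gibbsKernel p f n x h, ← integral_gibbsKernel p f n x hc,
    integral_sub (h.integrable_measure _) (integrable_const _)]
  simp

/-- The normalized iterates of the Ruelle operator become constant: they are trapped between two
sequences with a common limit. -/
theorem exists_gibbsMean_bounds (p : Measure M) [IsProbabilityMeasure p] (f : C(ℕ → M, ℝ))
    (hf : bowenConst f < ⊤) (φ : C(ℕ → M, ℝ)) :
    ∃ (a b : ℕ → ℝ) (l : ℝ), (∀ n z, gibbsMean p f n φ z ∈ Icc (a n) (b n)) ∧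
      Tendsto a atTop (𝓝 l) ∧ Tendsto b atTop (𝓝 l) := by
  obtain ⟨D, hD⟩ := exists_bound_of_bowenConst_lt_top hf
  obtain ⟨x₀⟩ : Nonempty (ℕ → M) := by
    have : Nonempty M := nonempty_of_isProbabilityMeasure p
    infer_instance
  have hφ := BddMeas.of_continuous φ
  have hc : ∀ n z, gibbsMean p f n φ z ∈ Icc (-‖φ‖) ‖φ‖ := fun n z =>
    gibbsMean_mem_Icc p f n hφ (fun x => abs_le.1 (φ.norm_coe_le_norm x)) z
  have hba : ∀ n, BddBelow (range (gibbsMean p f n φ)) := fun n =>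
    ⟨-‖φ‖, by rintro _ ⟨z, rfl⟩; exact (hc n z).1⟩
  have hbb : ∀ n, BddAbove (range (gibbsMean p f n φ)) := fun n =>
    ⟨‖φ‖, by rintro _ ⟨z, rfl⟩; exact (hc n z).2⟩
  have hmem : ∀ n z, gibbsMean p f n φ z ∈
      Icc (⨅ z, gibbsMean p f n φ z) (⨆ z, gibbsMean p f n φ z) := fun n z =>
    ⟨ciInf_le (hba n) z, le_ciSup (hbb n) z⟩
  have : Nonempty (ℕ → M) := ⟨x₀⟩
  have hψ : ∀ m, BddMeas fun x => gibbsMean p f m φ (shift^[m] x) := fun m =>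
    (BddMeas.of_continuous ⟨_, gibbsMean_continuous p f φ m⟩).comp_shift_iterate m
  have hmono : ∀ m k z, gibbsMean p f (m + k) φ z ∈
      Icc (⨅ z, gibbsMean p f m φ z) (⨆ z, gibbsMean p f m φ z) := fun m k z => by
    rw [← gibbsMean_comp_shift p f m k φ z]
    exact gibbsMean_mem_Icc p f _ (hψ m) (fun x => hmem m _) z
  suffices gap : ∀ m, ∀ ε : ℝ, 0 < ε → ∀ᶠ n in atTop,
      (⨆ z, gibbsMean p f n φ z) - (⨅ z, gibbsMean p f m φ z) ≤ Real.exp D * Real.exp D *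
        ((⨅ z, gibbsMean p f n φ z) - ⨅ z, gibbsMean p f m φ z) + ε by
    obtain ⟨l, hl⟩ := exists_common_limit
      (monotone_nat_of_le_succ fun n => le_ciInf fun z => (hmono n 1 z).1)
      (antitone_nat_of_succ_le fun n => ciSup_le fun z => (hmono n 1 z).2)
      (fun n => (hmem n x₀).1.trans (hmem n x₀).2) _ gap
    exact ⟨_, _, l, hmem, hl⟩
  intro m ε hε
  set K := Real.exp D * Real.exp D
  have hK : 0 < K := by positivity
  set a := ⨅ z, gibbsMean p f m φ z
  -- Subtracting the infimum makes `ψ` nonnegative, as the comparison requires; by consistency `A_n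
  -- ψ = A_n φ - a` for all `n ≥ m`.
  let ψ : C(ℕ → M, ℝ) := ⟨fun x => gibbsMean p f m φ (shift^[m] x) - a,
    ((gibbsMean_continuous p f φ m).comp (continuous_shift_iterate m)).sub continuous_const⟩
  -- The tolerance is `ε / K` because the comparison multiplies it by `K`.
  obtain ⟨N, hN⟩ := exists_forall_agree_abs_sub_lt ψ (div_pos hε hK)
  filter_upwards [eventually_ge_atTop (max N m)] with n hn
  obtain ⟨k, rfl⟩ := Nat.exists_eq_add_of_le ((le_max_right N m).trans hn)
  have hψn : ∀ z, gibbsMean p f (m + k) ψ z = gibbsMean p f (m + k) φ z - a := fun z => by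
    rw [← gibbsMean_comp_shift p f m k φ z, ← gibbsMean_sub_const p f _ (hψ m)]
    rfl
  have key : ∀ z w, gibbsMean p f (m + k) φ z - a ≤
      K * (gibbsMean p f (m + k) φ w - a) + ε := fun z w => by
    rw [← hψn, ← hψn]
    refine (gibbsMean_le_mul_add p f (m + k) (hD _) (BddMeas.of_continuous ψ)
      (fun x => sub_nonneg.2 (hmem m _).1) (ε := ε / K) (fun x y hxy => ?_) z w).trans_eq ?_
    · linarith [(abs_lt.1 (hN x y fun i hi => hxy i (hi.trans_le ((le_max_left _ _).trans hn)))).2]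
    · rw [mul_add, mul_div_cancel₀ _ hK.ne']
  have h1 : ∀ w, (⨆ z, gibbsMean p f (m + k) φ z) ≤
      K * (gibbsMean p f (m + k) φ w - a) + ε + a := fun w =>
    ciSup_le fun z => by linarith [key z w]
  -- Solved for the value at `w`, the inequality is a lower bound that passes to the infimum.
  have h2 : ((⨆ z, gibbsMean p f (m + k) φ z) - a - ε) / K + a ≤
      ⨅ z, gibbsMean p f (m + k) φ z := le_ciInf fun w => by
    have : ((⨆ z, gibbsMean p f (m + k) φ z) - a - ε) / K ≤ gibbsMean p f (m + k) φ w - a :=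
      (div_le_iff₀' hK).2 (by linarith [h1 w])
    linarith
  have h3 := (div_le_iff₀' hK).1 (le_sub_iff_add_le.2 h2)
  linarith

end Operator

/-! ### The limit measure, eigenprobabilities and DLR measures -/

section Operator

variable {M : Type*} [MetricSpace M] [CompactSpace M] [MeasurableSpace M] [BorelSpace M]

/-- The measure `ν` is the uniform limit of the normalized iterates of the Ruelle operator. -/
def IsGibbsLimit (p : Measure M) (f : C(ℕ → M, ℝ)) (ν : ProbabilityMeasure (ℕ → M)) : Prop :=
  ∀ φ : C(ℕ → M, ℝ), ∃ a b : ℕ → ℝ, (∀ n z, gibbsMean p f n φ z ∈ Icc (a n) (b n)) ∧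
    Tendsto a atTop (𝓝 (∫ x, φ x ∂(ν : Measure (ℕ → M)))) ∧
    Tendsto b atTop (𝓝 (∫ x, φ x ∂(ν : Measure (ℕ → M))))

/-- The kernels at a fixed point accumulate at some `ν` by compactness. Since their integrals of `φ`
already converge, the limit must be `∫ φ dν`. -/
theorem exists_isGibbsLimit (p : Measure M) [IsProbabilityMeasure p] (f : C(ℕ → M, ℝ))
    (hf : bowenConst f < ⊤) : ∃ ν, IsGibbsLimit p f ν := by
  have : Nonempty M := nonempty_of_isProbabilityMeasure p
  obtain ⟨x₀⟩ : Nonempty (ℕ → M) := inferInstance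
  let μs : ℕ → ProbabilityMeasure (ℕ → M) := fun n => ⟨gibbsKernel p f n x₀, inferInstance⟩
  obtain ⟨ν, -, hν⟩ := isCompact_univ.ultrafilter_le_nhds ((hyperfilter ℕ).map μs) (by simp)
  refine ⟨ν, fun φ => ?_⟩
  obtain ⟨a, b, l, hab, ha, hb⟩ := exists_gibbsMean_bounds p f hf φ
  suffices h : l = ∫ x, φ x ∂(ν : Measure (ℕ → M)) from ⟨a, b, hab, h ▸ ha, h ▸ hb⟩
  have h1 := ProbabilityMeasure.tendsto_iff_forall_integral_tendsto.1
    (show Tendsto μs (hyperfilter ℕ) (𝓝 ν) from hν) (BoundedContinuousFunction.mkOfCompact φ)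
  refine tendsto_nhds_unique (f := fun n => ∫ x, φ x ∂(μs n : Measure (ℕ → M))) ?_ h1
  have h2 : ∀ n, ∫ x, φ x ∂(μs n : Measure (ℕ → M)) ∈ Icc (a n) (b n) := fun n =>
    (integral_gibbsKernel p f n x₀ (BddMeas.of_continuous φ)).symm ▸ hab n _
  exact (tendsto_of_tendsto_of_tendsto_of_le_of_le ha hb (fun n => (h2 n).1)
    fun n => (h2 n).2).mono_left Nat.hyperfilter_le_atTop

theorem IsGibbsLimit.tendsto {p : Measure M} {f : C(ℕ → M, ℝ)}
    {ν : ProbabilityMeasure (ℕ → M)} (h : IsGibbsLimit p f ν) (φ : C(ℕ → M, ℝ)) (z : ℕ → M) :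
    Tendsto (fun n => gibbsMean p f n φ z) atTop (𝓝 (∫ x, φ x ∂(ν : Measure (ℕ → M)))) := by
  obtain ⟨a, b, hab, ha, hb⟩ := h φ
  exact tendsto_of_tendsto_of_tendsto_of_le_of_le ha hb (fun n => (hab n z).1)
    fun n => (hab n z).2

theorem probabilityMeasure_ext {μ ν : ProbabilityMeasure (ℕ → M)}
    (h : ∀ φ : C(ℕ → M, ℝ), ∫ x, φ x ∂(μ : Measure (ℕ → M)) = ∫ x, φ x ∂(ν : Measure (ℕ → M))) :
    μ = ν :=
  Subtype.ext (ext_of_forall_integral_eq_of_IsFiniteMeasure (μ := (μ : Measure (ℕ → M)))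
    (ν := (ν : Measure (ℕ → M))) fun φ => h φ.toContinuousMap)

/-- The uniqueness criterion shared by eigenprobabilities and DLR measures; `1 ≤ n` is all the DLR
equations offer. -/
theorem IsGibbsLimit.eq_of_forall_mem_Icc {p : Measure M} {f : C(ℕ → M, ℝ)}
    {μ ν : ProbabilityMeasure (ℕ → M)} (h : IsGibbsLimit p f ν)
    (hμ : ∀ (φ : C(ℕ → M, ℝ)) (n : ℕ) (a b : ℝ), 1 ≤ n →
      (∀ z, gibbsMean p f n φ z ∈ Icc a b) →
      ∫ x, φ x ∂(μ : Measure (ℕ → M)) ∈ Icc a b) : μ = ν := by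
  refine probabilityMeasure_ext fun φ => ?_
  obtain ⟨a, b, hab, ha, hb⟩ := h φ
  refine le_antisymm (ge_of_tendsto hb ?_) (le_of_tendsto ha ?_) <;>
    filter_upwards [eventually_ge_atTop 1] with n hn
  exacts [(hμ φ n _ _ hn (hab n)).2, (hμ φ n _ _ hn (hab n)).1]

theorem ruelleDual_toDual_eq_smul_iff (p : Measure M) [IsProbabilityMeasure p]
    (f : C(ℕ → M, ℝ)) (ν : ProbabilityMeasure (ℕ → M)) (c : ℝ) :
    ruelleDual p f (toDual ν) = c • toDual ν ↔ ∀ φ : C(ℕ → M, ℝ),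
      ∫ x, ruelleFun p f φ x ∂(ν : Measure (ℕ → M)) = c * ∫ x, φ x ∂(ν : Measure (ℕ → M)) :=
  ContinuousLinearMap.ext_iff

theorem integral_ruelleFun_one_pos (p : Measure M) [IsProbabilityMeasure p] (f : C(ℕ → M, ℝ))
    (ν : ProbabilityMeasure (ℕ → M)) :
    0 < ∫ x, ruelleFun p f (fun _ => 1) x ∂(ν : Measure (ℕ → M)) := by
  rw [integral_pos_iff_support_of_nonneg (f := ruelleFun p f fun _ => 1)
    (fun x => (iterate_ruelleFun_one_pos p f 1 x).le)
    (((BddMeas.const 1).ruelleFun p f).integrable_measure _)]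
  have : Function.support (ruelleFun p f fun _ => 1) = univ :=
    eq_univ_of_forall fun x => (iterate_ruelleFun_one_pos p f 1 x).ne'
  simp [this]

/-- An eigenprobability satisfies the eigenvalue equation for bounded measurable functions. -/
theorem integral_iterate_ruelleFun_of_eigen (p : Measure M) [IsProbabilityMeasure p]
    (f : C(ℕ → M, ℝ)) (ν : ProbabilityMeasure (ℕ → M)) {c : ℝ}
    (h : ∀ φ : C(ℕ → M, ℝ), ∫ x, ruelleFun p f φ x ∂(ν : Measure (ℕ → M)) =
      c * ∫ x, φ x ∂(ν : Measure (ℕ → M))) {φ : (ℕ → M) → ℝ} (hφ : BddMeas φ) (n : ℕ) :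
    ∫ x, (ruelleFun p f)^[n] φ x ∂(ν : Measure (ℕ → M)) =
      c ^ n * ∫ x, φ x ∂(ν : Measure (ℕ → M)) := by
  have hc : 0 ≤ c := by
    have h1 := h 1
    have h2 := integral_ruelleFun_one_pos p f ν
    simp only [ContinuousMap.one_apply, integral_const, probReal_univ, smul_eq_mul,
      mul_one] at h1
    exact h1 ▸ h2.le
  obtain ⟨m, hm, hmφ⟩ := exists_measure_integral_ruelleFun p f (ν : Measure (ℕ → M))
  -- Two finite measures that agree on continuous functions coincide, which extends the equation to
  -- measurable functions.
  have key : m = ENNReal.ofReal c • (ν : Measure (ℕ → M)) := by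
    have : IsFiniteMeasure (ENNReal.ofReal c • (ν : Measure (ℕ → M))) :=
      (ν : Measure (ℕ → M)).smul_finite ENNReal.ofReal_ne_top
    refine ext_of_forall_integral_eq_of_IsFiniteMeasure fun φ => ?_
    rw [integral_smul_measure, ENNReal.toReal_ofReal hc, smul_eq_mul]
    exact (hmφ _ (BddMeas.of_continuous φ.toContinuousMap)).symm.trans (h φ.toContinuousMap)
  induction n generalizing φ with
  | zero => simp
  | succ n ih =>
    rw [Function.iterate_succ_apply, ih (hφ.ruelleFun p f), hmφ φ hφ, key,
      integral_smul_measure, ENNReal.toReal_ofReal hc, smul_eq_mul, pow_succ, mul_assoc]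

/-- Integrate `a L^n 1 ≤ L^n φ ≤ b L^n 1` against `μ` and divide by `c^n = ∫ L^n 1 dμ`. The
eigenvalue `c` is arbitrary. -/
theorem IsGibbsLimit.eq_of_eigen {p : Measure M} [IsProbabilityMeasure p] {f : C(ℕ → M, ℝ)}
    {μ ν : ProbabilityMeasure (ℕ → M)} (h : IsGibbsLimit p f ν) {c : ℝ}
    (hμ : ruelleDual p f (toDual μ) = c • toDual μ) : μ = ν := by
  rw [ruelleDual_toDual_eq_smul_iff] at hμ
  refine h.eq_of_forall_mem_Icc fun φ n a b _ hab => ?_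
  have hint := fun {ψ : (ℕ → M) → ℝ} (hψ : BddMeas ψ) =>
    integral_iterate_ruelleFun_of_eigen p f μ hμ hψ n
  have hφ := BddMeas.of_continuous φ
  have h1 := hint (BddMeas.const 1)
  have hpos : 0 < c ^ n := by
    have := integral_ruelleFun_one_pos p f μ
    have h0 := hμ 1
    simp only [ContinuousMap.one_apply, integral_const, probReal_univ, smul_eq_mul,
      mul_one] at h0
    exact pow_pos (h0 ▸ this) n
  simp only [integral_const, probReal_univ, smul_eq_mul, mul_one] at h1
  have hI1 := ((BddMeas.const (M := M) 1).iterate p f n).integrable_measure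
    (μ : Measure (ℕ → M))
  have hIφ := (hφ.iterate p f n).integrable_measure (μ : Measure (ℕ → M))
  constructor
  · refine le_of_mul_le_mul_left ?_ hpos
    rw [← hint hφ, ← h1, mul_comm, ← integral_const_mul]
    refine integral_mono (hI1.const_mul a) hIφ fun z => ?_
    exact (le_div_iff₀ (iterate_ruelleFun_one_pos p f n z)).1 (hab z).1
  · refine le_of_mul_le_mul_left ?_ hpos
    rw [← hint hφ, ← h1, mul_comm, ← integral_const_mul]
    refine integral_mono hIφ (hI1.const_mul b) fun z => ?_
    exact (div_le_iff₀ (iterate_ruelleFun_one_pos p f n z)).1 (hab z).2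

/-- Let `n → ∞` in `A_n(L φ) = A_n(L 1) · A_{n+1} φ`. -/
theorem IsGibbsLimit.ruelleDual_eq {p : Measure M} [IsProbabilityMeasure p] {f : C(ℕ → M, ℝ)}
    {ν : ProbabilityMeasure (ℕ → M)} (h : IsGibbsLimit p f ν) :
    ruelleDual p f (toDual ν) = ruelleDual p f (toDual ν) 1 • toDual ν := by
  rw [ruelleDual_toDual_eq_smul_iff]
  intro φ
  have : Nonempty M := nonempty_of_isProbabilityMeasure p
  obtain ⟨z⟩ : Nonempty (ℕ → M) := inferInstance
  have h1 := h.tendsto (ruelleOp p f φ) z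
  have h2 := h.tendsto (ruelleOp p f 1) z
  have h3 := (h.tendsto φ z).comp (tendsto_add_atTop_nat 1)
  refine tendsto_nhds_unique h1 ((h2.mul h3).congr fun n => ?_)
  have hn := (iterate_ruelleFun_one_pos p f n z).ne'
  have hn' := (iterate_ruelleFun_one_pos p f (n + 1) z).ne'
  show (ruelleFun p f)^[n + 1] (fun _ => 1) z / _ * ((ruelleFun p f)^[n + 1] φ z / _) =
    (ruelleFun p f)^[n + 1] φ z / _
  field_simp

/-- A normalized fixed point is an eigenprobability for some eigenvalue, hence is `ν`: the supremum
runs over one number. -/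
theorem IsGibbsLimit.eigenvalue_eq {p : Measure M} [IsProbabilityMeasure p] {f : C(ℕ → M, ℝ)}
    {ν : ProbabilityMeasure (ℕ → M)} (h : IsGibbsLimit p f ν) :
    eigenvalue p f = ruelleDual p f (toDual ν) 1 := by
  have hne : ∀ γ : ProbabilityMeasure (ℕ → M), ruelleDual p f (toDual γ) 1 ≠ 0 := fun γ =>
    (integral_ruelleFun_one_pos p f γ).ne'
  rw [eigenvalue, ← csSup_singleton (ruelleDual p f (toDual ν) 1)]
  congr 1
  ext r
  simp only [Set.mem_ofPred_eq, Set.mem_singleton_iff]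
  constructor
  · rintro ⟨γ, hγ, rfl⟩
    rw [inv_smul_eq_iff₀ (hne γ)] at hγ
    rw [h.eq_of_eigen hγ]
  · rintro rfl
    exact ⟨ν, (inv_smul_eq_iff₀ (hne ν)).2 h.ruelleDual_eq, rfl⟩

theorem IsGibbsLimit.eigenProbs_eq {p : Measure M} [IsProbabilityMeasure p] {f : C(ℕ → M, ℝ)}
    {ν : ProbabilityMeasure (ℕ → M)} (h : IsGibbsLimit p f ν) : eigenProbs p f = {ν} := by
  ext μ
  refine ⟨fun hμ => h.eq_of_eigen hμ, ?_⟩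
  rintro rfl
  rw [eigenProbs, Set.mem_ofPred_eq, h.eigenvalue_eq]
  exact h.ruelleDual_eq

theorem tailSigma_le (n : ℕ) : tailSigma M n ≤ MeasurableSpace.pi := by
  rw [tailSigma_eq_comap]
  exact (measurable_shift_iterate n).comap_le

/-- Eigenprobabilities are DLR measures. -/
theorem mem_dlrMeasures_of_eigen {p : Measure M} [IsProbabilityMeasure p] {f : C(ℕ → M, ℝ)}
    {ν : ProbabilityMeasure (ℕ → M)} {c : ℝ} (hc : c ≠ 0)
    (h : ruelleDual p f (toDual ν) = c • toDual ν) : ν ∈ dlrMeasures p f := by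
  rw [ruelleDual_toDual_eq_smul_iff] at h
  intro n _ φ
  have hφ := BddMeas.of_continuous φ
  have hA := BddMeas.of_continuous ⟨_, gibbsMean_continuous p f φ n⟩
  simp only [integral_gibbsKernel p f n _ hφ]
  refine (ae_eq_condExp_of_forall_setIntegral_eq (tailSigma_le n) (hφ.integrable_measure _)
    (fun s _ _ => ((hA.comp_shift_iterate n).integrable_measure _).integrableOn)
    (fun s hs _ => ?_) ?_).symm
  · have hs' := tailSigma_le n s hs
    rw [tailSigma_eq_comap] at hs
    obtain ⟨B, hB, rfl⟩ := hs
    rw [← integral_indicator hs', ← integral_indicator hs']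
    have hind : ∀ ψ : (ℕ → M) → ℝ, (shift^[n] ⁻¹' B).indicator ψ =
        fun x => B.indicator (fun _ => (1 : ℝ)) (shift^[n] x) * ψ x := fun ψ => by
      ext x
      by_cases hx : shift^[n] x ∈ B
      · rw [Set.indicator_of_mem (show x ∈ shift^[n] ⁻¹' B from hx), Set.indicator_of_mem hx,
          one_mul]
      · rw [Set.indicator_of_notMem (show x ∉ shift^[n] ⁻¹' B from hx),
          Set.indicator_of_notMem hx, zero_mul]
    rw [hind, hind]
    have h1 := (BddMeas.indicator hB).comp_shift_iterate n
    -- The factor `c^n` allows `L^n` to be inserted in both integrals. It lets `1_B ∘ σ^n` through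
    -- and maps `φ` and `A_n φ ∘ σ^n` to the same function.
    refine mul_left_cancel₀ (pow_ne_zero n hc) ?_
    rw [← integral_iterate_ruelleFun_of_eigen p f ν h (h1.mul hφ) n,
      ← integral_iterate_ruelleFun_of_eigen p f ν h (h1.mul (hA.comp_shift_iterate n)) n]
    congr 1
    ext x
    rw [iterate_ruelleFun_comp_shift_mul, iterate_ruelleFun_comp_shift_mul]
    have := iterate_ruelleFun_comp_shift_mul p f (gibbsMean p f n φ) (fun _ => 1) n x
    simp only [mul_one] at this
    rw [iterate_ruelleFun_eq_gibbsMean_mul p f n φ, ← this]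
    rfl
  · refine StronglyMeasurable.aestronglyMeasurable (Measurable.stronglyMeasurable ?_)
    rw [tailSigma_eq_comap]
    exact hA.1.comp (comap_measurable _)

/-- Taking expectations in the DLR equation gives `∫ φ dμ = ∫ A_n φ ∘ σ^n dμ`, a mean of values of
`A_n φ`. -/
theorem IsGibbsLimit.dlrMeasures_eq {p : Measure M} [IsProbabilityMeasure p] {f : C(ℕ → M, ℝ)}
    {ν : ProbabilityMeasure (ℕ → M)} (h : IsGibbsLimit p f ν) : dlrMeasures p f = {ν} := by
  ext μ
  refine ⟨fun hμ => h.eq_of_forall_mem_Icc fun φ n a b hn hab => ?_, ?_⟩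
  · have hφ := BddMeas.of_continuous φ
    have hA := (BddMeas.of_continuous ⟨_, gibbsMean_continuous p f φ n⟩).comp_shift_iterate n
    have hI := hA.integrable_measure (μ : Measure (ℕ → M))
    have : ∫ x, φ x ∂(μ : Measure (ℕ → M)) =
        ∫ x, gibbsMean p f n φ (shift^[n] x) ∂(μ : Measure (ℕ → M)) := by
      rw [← integral_condExp (tailSigma_le n), integral_congr_ae (hμ n hn φ)]
      simp only [integral_gibbsKernel p f n _ hφ]
    rw [this]
    constructor
    · simpa using integral_mono (integrable_const a) hI fun x => (hab _).1
    · simpa using integral_mono hI (integrable_const b) fun x => (hab _).2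
  · rintro rfl
    exact mem_dlrMeasures_of_eigen (integral_ruelleFun_one_pos p f μ).ne' h.ruelleDual_eq

end Operator

/-! ### Regularity conditions that make `D` finite -/

theorem abs_birkhoff_le {M : Type*} [TopologicalSpace M] [CompactSpace M]
    (f : C(ℕ → M, ℝ)) (n : ℕ) (x : ℕ → M) : |birkhoff f n x| ≤ n * ‖f‖ := by
  refine (Finset.abs_sum_le_sum_abs _ _).trans ?_
  simpa using Finset.sum_le_card_nsmul (Finset.range n) (fun j => |f (shift^[j] x)|) ‖f‖
    fun j _ => f.norm_coe_le_norm _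

/-- To bound `D` it suffices to bound `S_n f x - S_n f y` for `x`, `y` that agree on the first
`n + N` coordinates. -/
theorem bowenConst_lt_top_of_agree {M : Type*} [TopologicalSpace M] [CompactSpace M]
    (f : C(ℕ → M, ℝ)) (N : ℕ) (C : ℝ)
    (h : ∀ n, 1 ≤ n → ∀ x y : ℕ → M, (∀ i < n + N, x i = y i) →
      |birkhoff f n x - birkhoff f n y| ≤ C) : bowenConst f < ⊤ := by
  refine lt_of_le_of_lt (iSup₂_le fun n _ => iSup₂_le fun x y => iSup_le fun hxy =>
    ENNReal.ofReal_le_ofReal (q := |C| + 2 * (N * ‖f‖)) ?_) ENNReal.ofReal_lt_top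
  have hsub : ∀ k ≤ N, ∀ u v : ℕ → M, |birkhoff f k u - birkhoff f k v| ≤ 2 * (N * ‖f‖) :=
    fun k hk u v => by
      have hkN : (k : ℝ) * ‖f‖ ≤ N * ‖f‖ := by gcongr
      have := abs_sub (birkhoff f k u) (birkhoff f k v)
      linarith [abs_birkhoff_le f k u, abs_birkhoff_le f k v]
  rcases le_or_gt n N with hn | hn
  · exact (hsub n hn x y).trans (le_add_of_nonneg_left (abs_nonneg C))
  · obtain ⟨k, rfl⟩ := Nat.exists_eq_add_of_lt hn
    -- The first `k + 1` terms fall under the hypothesis; the last `N` are bounded trivially.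
    have hk : N + k + 1 = (k + 1) + N := by ring
    rw [hk] at hxy ⊢
    rw [birkhoff_add f (k + 1), birkhoff_add f (k + 1) N y, add_sub_add_comm]
    exact (abs_add_le _ _).trans (add_le_add
      ((h (k + 1) (Nat.le_add_left 1 k) x y hxy).trans (le_abs_self C)) (hsub N le_rfl _ _))

section Metric

variable {M : Type*} [MetricSpace M] [CompactSpace M]

/-- The first `k` terms vanish and the remaining weights add up to `2^{-k}`. -/
theorem dOmega_le_of_agree (k : ℕ) (x y : ℕ → M) (h : ∀ i < k, x i = y i) :
    dOmega x y ≤ (1 / 2 : ℝ) ^ k * Metric.diam (univ : Set M) := by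
  have hd : ∀ n, dist (x n) (y n) ≤ Metric.diam (univ : Set M) := fun n =>
    Metric.dist_le_diam_of_mem isCompact_univ.isBounded (mem_univ _) (mem_univ _)
  have hg := (summable_geometric_two.mul_left (1 / 2 : ℝ)).mul_right (Metric.diam (univ : Set M))
  have hs : Summable fun n : ℕ => (1 / 2 : ℝ) ^ (n + 1) * dist (x n) (y n) :=
    Summable.of_nonneg_of_le (fun n => by positivity)
      (fun n => by rw [pow_succ']; gcongr; exact hd n) hg
  have hz : ∑ i ∈ Finset.range k, (1 / 2 : ℝ) ^ (i + 1) * dist (x i) (y i) = 0 :=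
    Finset.sum_eq_zero fun i hi => by rw [h i (Finset.mem_range.1 hi), dist_self, mul_zero]
  rw [dOmega, ← hs.sum_add_tsum_nat_add k, hz, zero_add]
  have h2 : HasSum (fun n : ℕ => (1 / 2 : ℝ) ^ k * Metric.diam (univ : Set M) *
      (1 / 2 * (1 / 2) ^ n)) ((1 / 2 : ℝ) ^ k * Metric.diam (univ : Set M)) := by
    simpa using (hasSum_geometric_two.mul_left (1 / 2 : ℝ)).mul_left
      ((1 / 2 : ℝ) ^ k * Metric.diam (univ : Set M))
  refine (Summable.tsum_le_tsum (fun n => ?_) ((summable_nat_add_iff k).2 hs)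
    h2.summable).trans_eq h2.tsum_eq
  calc (1 / 2 : ℝ) ^ (n + k + 1) * dist (x (n + k)) (y (n + k))
      ≤ (1 / 2 : ℝ) ^ (n + k + 1) * Metric.diam (univ : Set M) := by gcongr; exact hd _
    _ = _ := by ring

theorem exists_dOmega_lt {δ : ℝ} (hδ : 0 < δ) :
    ∃ N, ∀ x y : ℕ → M, (∀ i < N, x i = y i) → dOmega x y < δ := by
  have : Tendsto (fun k : ℕ => (1 / 2 : ℝ) ^ k * Metric.diam (univ : Set M)) atTop (𝓝 0) := by
    simpa using (tendsto_pow_atTop_nhds_zero_of_lt_one (by norm_num : (0 : ℝ) ≤ 1 / 2)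
      (by norm_num)).mul_const (Metric.diam (univ : Set M))
  obtain ⟨N, hN⟩ := (this.eventually_lt_const hδ).exists
  exact ⟨N, fun x y h => (dOmega_le_of_agree N x y h).trans_lt hN⟩

/-- If `x`, `y` agree on `n + N` coordinates, every `σ^i x`, `σ^i y` with `i < n` still agree on
`N`, so the orbits stay `δ`-close. -/
theorem IsBowen.bowenConst_lt_top {f : C(ℕ → M, ℝ)} (h : IsBowen f) : bowenConst f < ⊤ := by
  obtain ⟨δ, hδ, C, hC⟩ := h
  obtain ⟨N, hN⟩ := exists_dOmega_lt (M := M) hδ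
  refine bowenConst_lt_top_of_agree f N C fun n hn x y hxy => hC n hn x y fun i hi => ?_
  refine hN _ _ fun j hj => ?_
  rw [shift_iterate_apply, shift_iterate_apply]
  exact hxy _ (by omega)

theorem IsWalters.isBowen {M : Type*} [MetricSpace M] {f : (ℕ → M) → ℝ} (h : IsWalters f) :
    IsBowen f := by
  obtain ⟨δ, hδ, h⟩ := h 1 one_pos
  exact ⟨δ, hδ, 1, fun n hn x y hxy => (h n hn x y hxy).le⟩

theorem IsWeakWalters.bowenConst_lt_top {f : C(ℕ → M, ℝ)} (h : IsWeakWalters f) :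
    bowenConst f < ⊤ := by
  obtain ⟨δ, hδ, h⟩ := h 1 one_pos
  obtain ⟨N, hN⟩ := exists_dOmega_lt (M := M) hδ
  refine bowenConst_lt_top_of_agree f N 1 fun n hn x y hxy =>
    (h n hn x y (fun i hi => hxy i (by omega)) (hN _ _ fun j hj => ?_)).le
  rw [shift_iterate_apply, shift_iterate_apply]
  exact hxy _ (by omega)

theorem dOmega_nonneg (x y : ℕ → M) : 0 ≤ dOmega x y :=
  tsum_nonneg fun n => by positivity

/-- After `j` shifts `n - j` common coordinates remain, so the `j`-th difference is of order
`2^{-γ(n-j)}` and the sum is geometric. -/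
theorem IsHolder.bowenConst_lt_top {f : C(ℕ → M, ℝ)} (h : IsHolder f) : bowenConst f < ⊤ := by
  obtain ⟨γ, hγ, -, C, hC⟩ := h
  set d := Metric.diam (univ : Set M)
  have hd : 0 ≤ d := Metric.diam_nonneg
  set r : ℝ := (1 / 2 : ℝ) ^ γ
  have hr0 : 0 ≤ r := by positivity
  have hr1 : r < 1 := Real.rpow_lt_one (by norm_num) (by norm_num) hγ
  refine bowenConst_lt_top_of_agree f 0 (|C| * d ^ γ * (1 - r)⁻¹) fun n _ x y hxy => ?_
  have hterm : ∀ j ∈ Finset.range n, |f (shift^[j] x) - f (shift^[j] y)| ≤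
      |C| * d ^ γ * r ^ (n - j) := fun j hj => by
    have h1 : dOmega (shift^[j] x) (shift^[j] y) ≤ (1 / 2 : ℝ) ^ (n - j) * d :=
      dOmega_le_of_agree _ _ _ fun i hi => by
        rw [shift_iterate_apply, shift_iterate_apply]
        exact hxy _ (by omega)
    calc _ ≤ C * dOmega (shift^[j] x) (shift^[j] y) ^ γ := hC _ _
      _ ≤ |C| * ((1 / 2 : ℝ) ^ (n - j) * d) ^ γ :=
        mul_le_mul (le_abs_self C) (Real.rpow_le_rpow (dOmega_nonneg _ _) h1 hγ.le)
          (Real.rpow_nonneg (dOmega_nonneg _ _) _) (abs_nonneg C)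
      _ = _ := by
        rw [Real.mul_rpow (by positivity) hd, ← Real.rpow_natCast (1 / 2 : ℝ), ← Real.rpow_mul
          (by norm_num), mul_comm ((n - j : ℕ) : ℝ), Real.rpow_mul (by norm_num),
          Real.rpow_natCast]
        ring
  rw [birkhoff, birkhoff, ← Finset.sum_sub_distrib]
  refine (Finset.abs_sum_le_sum_abs _ _).trans ((Finset.sum_le_sum hterm).trans ?_)
  rw [← Finset.mul_sum]
  refine mul_le_mul_of_nonneg_left ?_ (by positivity)
  -- Lowering the exponent by one only enlarges the sum and fits the reflection `j ↦ n - 1 - j`.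
  calc ∑ j ∈ Finset.range n, r ^ (n - j) ≤ ∑ j ∈ Finset.range n, r ^ (n - 1 - j) :=
        Finset.sum_le_sum fun j hj => pow_le_pow_of_le_one hr0 hr1.le (by omega)
    _ = ∑ j ∈ Finset.range n, r ^ j := Finset.sum_range_reflect (fun j => r ^ j) n
    _ ≤ ∑' j, r ^ j := (summable_geometric_of_lt_one hr0 hr1).sum_le_tsum _
        fun j _ => pow_nonneg hr0 j
    _ = (1 - r)⁻¹ := tsum_geometric_of_lt_one hr0 hr1

end Metric

end RuelleDLR

end

theorem mainTheorem6 {M : Type*} [MetricSpace M] [CompactSpace M] [MeasurableSpace M]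
    [BorelSpace M] (p : Measure M) [IsProbabilityMeasure p] [p.IsOpenPosMeasure]
    (f : C(ℕ → M, ℝ)) :
    (RuelleDLR.bowenConst f < ⊤ →
      ∃ ν : ProbabilityMeasure (ℕ → M),
        RuelleDLR.eigenProbs p f = {ν} ∧ RuelleDLR.dlrMeasures p f = {ν}) ∧
    (RuelleDLR.IsHolder f ∨ RuelleDLR.IsWeakWalters f ∨ RuelleDLR.IsWalters f ∨
      RuelleDLR.IsBowen f → RuelleDLR.bowenConst f < ⊤) := by
  refine ⟨fun hf => ?_, ?_⟩
  · obtain ⟨ν, hν⟩ := RuelleDLR.exists_isGibbsLimit p f hf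
    exact ⟨ν, hν.eigenProbs_eq, hν.dlrMeasures_eq⟩
  · rintro (h | h | h | h)
    exacts [h.bowenConst_lt_top, h.bowenConst_lt_top, h.isBowen.bowenConst_lt_top,
      h.bowenConst_lt_top]
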